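/- Let $A$ be a unital locally $C^*$-algebra with respect to a family $\{P_\alpha\}_{\alpha\in\Delta}$ of $C^*$-seminorms; that is, $A$ is a unital complex $*$-algebra, each $P_\alpha$ is a seminorm with $P_\alpha(ab)\le P_\alpha(a)P_\alpha(b)$, $P_\alpha(a^*)=P_\alpha(a)$ and $P_\alpha(a^*a)=P_\alpha(a)^2$, and $A$ is Hausdorff and complete in the locally convex topology given by the family. An element $a$ of a unital complex $*$-algebra is called positive if $a=a^*$ and its spectrum is contained in $[0,\infty)$. Let $X$ be a Hilbert $A$-module: a right $A$-module with an $A$-valued inner product $\langle\cdot,\cdot\rangle$ (additive in the first variable, $\langle xa,y\rangle=\langle x,y\rangle a$, $\langle x,y\rangle^*=\langle y,x\rangle$, $\langle x,x\rangle\ge 0$, and $\langle x,x\rangle=0$ iff $x=0$) which is complete with respect to the seminorms $\bar P_\alpha(x)=P_\alpha(\langle x,x\rangle)^{1/2}$, $\alpha\in\Delta$. Let $\mathrm{End}^*_A(X)$ be the $*$-algebra of all bounded adjointable operators on $X$, i.e. of the $\mathbb C$-linear $A$-homomorphisms $T:X\to X$ such that for each $\alpha$ there is $C_\alpha>0$ with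 $\bar P_\alpha(Tx)\le C_\alpha\bar P_\alpha(x)$ for all $x\in X$, and for which there is an operator $T^*$ of the same kind with $\langle Tx,y\rangle=\langle x,T^*y\rangle$ for all $x,y\in X$. For $\alpha\in\Delta$ put $I_\alpha=\{a\in A: P_\alpha(a)=0\}$ and $A_\alpha=A/I_\alpha$ with the norm $\|a+I_\alpha\|=P_\alpha(a)$. Put $\bar I_\alpha=\{x\in X:\langle x,x\rangle\in I_\alpha\}$, and let $X_\alpha=X/\bar I_\alpha$ be the $A_\alpha$-module with $(x+\bar I_\alpha)(a+I_\alpha)=xa+\bar I_\alpha$ and the inner product $\langle x+\bar I_\alpha,y+\bar I_\alpha\rangle=\langle x,y\rangle+I_\alpha$. For $T\in\mathrm{End}^*_A(X)$ let $T_\alpha\in\mathrm{End}^*_{A_\alpha}(X_\alpha)$ be the induced operator $T_\alpha(x+\bar I_\alpha)=Tx+\bar I_\alpha$. Proposition 3.1. Let $T\in\mathrm{End}^*_A(X)$. Then a) $\mathrm{Sp}(T)=\bigcup_{\alpha\in\Delta}\mathrm{Sp}(T_\alpha)$, where $\mathrm{Sp}(T)$ is the spectrum of $T$ in $\mathrm{End}^*_A(X)$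 and $\mathrm{Sp}(T_\alpha)$ is the spectrum of $T_\alpha$ in $\mathrm{End}^*_{A_\alpha}(X_\alpha)$; b) $T$ is self-adjoint if and only if $T_\alpha$ is self-adjoint for every $\alpha\in\Delta$; c) $T$ is a positive element of $\mathrm{End}^*_A(X)$ if and only if $T_\alpha$ is a positive element of $\mathrm{End}^*_{A_\alpha}(X_\alpha)$ for every $\alpha\in\Delta$. -/

import Mathlib

open scoped MulOpposite

universe u

set_option linter.unusedSectionVars false

noncomputable section

namespace LCStar

/-! ### Positive elements and families of C*-seminorms -/

/-- An element of a unital complex `*`-algebra is positive if it is Hermitian and its spectrum is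
contained in `[0, ∞)`. -/
def IsPositiveElem {A : Type*} [Ring A] [StarRing A] [Algebra ℂ A] (a : A) : Prop :=
  IsSelfAdjoint a ∧ spectrum ℂ a ⊆ (fun r : ℝ => (r : ℂ)) '' Set.Ici 0

/-- A C*-seminorm: a submultiplicative, `*`-invariant seminorm with the C*-identity. -/
structure CStarSeminorm (A : Type*) [Ring A] [StarRing A] [Algebra ℂ A]
    extends Seminorm ℂ A where
  mul_le' : ∀ a b : A, toFun (a * b) ≤ toFun a * toFun b
  star_eq' : ∀ a : A, toFun (star a) = toFun a
  star_mul_self' : ∀ a : A, toFun (star a * a) = toFun a ^ 2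

/-- A family of seminorms separates the points. -/
def Separating {E Δ : Type*} [AddCommGroup E] [Module ℂ E] (P : Δ → Seminorm ℂ E) : Prop :=
  ∀ x : E, (∀ α, P α x = 0) → x = 0

/-- The uniform structure of the locally convex topology given by a family of seminorms. -/
abbrev seminormUniformSpace {E Δ : Type*} [AddCommGroup E] [Module ℂ E]
    (P : Δ → Seminorm ℂ E) : UniformSpace E :=
  ⨅ α, (P α).toSeminormedAddCommGroup.toUniformSpace

/-- `E` is a complete Hausdorff locally convex space with respect to the family `P`. -/
structure IsCompleteHausdorff {E Δ : Type*} [AddCommGroup E] [Module ℂ E]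
    (P : Δ → Seminorm ℂ E) : Prop where
  separating : Separating P
  complete : @CompleteSpace E (seminormUniformSpace P)

/-- The unital complex `*`-algebra `A` is a locally C*-algebra with respect to the family `P` of
C*-seminorms. -/
def IsLocallyCStarAlgebra {A Δ : Type*} [Ring A] [StarRing A] [Algebra ℂ A]
    (P : Δ → CStarSeminorm A) : Prop :=
  IsCompleteHausdorff fun α => (P α).toSeminorm

/-! ### Pre-Hilbert modules -/

/-- An `A`-valued inner product on a right `A`-module `X` (right modules over `A` are left modules
over the opposite ring; `x a` is `MulOpposite.op a • x`). -/
class PreHilbertModule (A X : Type*) [Ring A] [StarRing A] [Algebra ℂ A] [AddCommGroup X]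
    [Module Aᵐᵒᵖ X] where
  ip : X → X → A
  ip_self_pos : ∀ x, IsPositiveElem (ip x x)
  ip_self_eq_zero : ∀ x, ip x x = 0 ↔ x = 0
  ip_add_left : ∀ x₁ x₂ y, ip (x₁ + x₂) y = ip x₁ y + ip x₂ y
  ip_smul_left : ∀ (x y : X) (a : A), ip (MulOpposite.op a • x) y = ip x y * a
  star_ip : ∀ x y, star (ip x y) = ip y x

namespace CStarSeminorm

variable {A : Type*} [Ring A] [StarRing A] [Algebra ℂ A] (p : CStarSeminorm A)

instance : CoeFun (CStarSeminorm A) fun _ => A → ℝ := ⟨fun p => p.toSeminorm⟩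

lemma mul_le (a b : A) : p (a * b) ≤ p a * p b := p.mul_le' a b
lemma star_eq (a : A) : p (star a) = p a := p.star_eq' a
lemma star_mul_self (a : A) : p (star a * a) = p a ^ 2 := p.star_mul_self' a
lemma nonneg (a : A) : 0 ≤ p a := apply_nonneg p.toSeminorm a

/-- The norm of the C*-completion: a C*-seminorm is the pullback of a C*-norm. -/
lemma exists_completion {A : Type u} [Ring A] [StarRing A] [Algebra ℂ A] [StarModule ℂ A]
    (p : CStarSeminorm A) :
    ∃ (B : Type u) (_ : CStarAlgebra B) (φ : A →⋆ₐ[ℂ] B), ∀ a, ‖φ a‖ = p a := by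
  let : SeminormedRing A :=
    { p.toSeminorm.toSeminormedAddCommGroup, (inferInstance : Ring A) with
      norm_mul_le := fun a b => p.mul_le a b }
  have hn : ∀ a : A, ‖a‖ = p a := fun _ => rfl
  let : NormedSpace ℂ A := ⟨fun c a => (map_smul_eq_mul p.toSeminorm c a).le⟩
  let : NormedAlgebra ℂ A := ⟨fun c a => norm_smul_le c a⟩
  have hiso : Isometry (star : A → A) := by
    refine Isometry.of_dist_eq fun a b => ?_
    rw [dist_eq_norm, dist_eq_norm, ← star_sub, hn, hn, p.star_eq]
  have huc : UniformContinuous (star : A → A) := hiso.uniformContinuous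
  let C := UniformSpace.Completion A
  have hcs : Continuous (UniformSpace.Completion.map (star : A → A)) :=
    UniformSpace.Completion.continuous_map
  have hco : ∀ a : A, UniformSpace.Completion.map (star : A → A) (a : C) = ((star a : A) : C) :=
    fun a => UniformSpace.Completion.map_coe huc a
  let : Star C := ⟨UniformSpace.Completion.map star⟩
  have hcs' : Continuous (star : C → C) := hcs
  have hco' : ∀ a : A, star (a : C) = ((star a : A) : C) := hco
  let : StarRing C :=
    { star_involutive := fun x => by
        induction x using UniformSpace.Completion.induction_on with
        | hp => exact isClosed_eq (hcs'.comp hcs') continuous_id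
        | ih a => rw [hco', hco', star_star]
      star_mul := fun x y => by
        induction x, y using UniformSpace.Completion.induction_on₂ with
        | hp => exact isClosed_eq (hcs'.comp continuous_mul)
                  ((hcs'.comp continuous_snd).mul (hcs'.comp continuous_fst))
        | ih a b => rw [hco', hco', ← UniformSpace.Completion.coe_mul, hco', star_mul,
                      UniformSpace.Completion.coe_mul]
      star_add := fun x y => by
        induction x, y using UniformSpace.Completion.induction_on₂ with
        | hp => exact isClosed_eq (hcs'.comp continuous_add)
                  ((hcs'.comp continuous_fst).add (hcs'.comp continuous_snd))
        | ih a b => rw [hco', hco', ← UniformSpace.Completion.coe_add, hco', star_add,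
                      UniformSpace.Completion.coe_add] }
  have : StarModule ℂ C := ⟨fun c x => by
    induction x using UniformSpace.Completion.induction_on with
    | hp => exact isClosed_eq (hcs'.comp (continuous_const_smul c))
              (hcs'.const_smul (star c))
    | ih a => rw [hco', ← UniformSpace.Completion.coe_smul, hco', star_smul,
                UniformSpace.Completion.coe_smul]⟩
  have : CStarRing C := ⟨fun x => by
    induction x using UniformSpace.Completion.induction_on with
    | hp => exact isClosed_le (continuous_norm.mul continuous_norm)
              (continuous_norm.comp (hcs'.mul continuous_id))
    | ih a =>
      rw [hco', ← UniformSpace.Completion.coe_mul, UniformSpace.Completion.norm_coe,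
        UniformSpace.Completion.norm_coe, hn, hn, p.star_mul_self, pow_two]⟩
  let : NormedAlgebra ℂ C := ⟨fun c x => norm_smul_le c x⟩
  let φ : A →⋆ₐ[ℂ] C :=
    { toFun := fun a => (a : C)
      map_one' := UniformSpace.Completion.coe_one A
      map_mul' := UniformSpace.Completion.coe_mul
      map_zero' := UniformSpace.Completion.coe_zero
      map_add' := UniformSpace.Completion.coe_add
      commutes' := fun _ => rfl
      map_star' := fun a => (hco' a).symm }
  refine ⟨C, {}, φ, fun a => ?_⟩
  exact UniformSpace.Completion.norm_coe a

end CStarSeminorm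

section PreHilbert

open PreHilbertModule

variable {A X : Type*} [Ring A] [StarRing A] [Algebra ℂ A] [StarModule ℂ A] [AddCommGroup X]
  [Module ℂ X] [Module Aᵐᵒᵖ X] [IsScalarTower ℂ Aᵐᵒᵖ X] [PreHilbertModule A X]

variable (A) in
lemma ip_add_right (x y₁ y₂ : X) : (ip x (y₁ + y₂) : A) = ip x y₁ + ip x y₂ := by
  rw [← star_ip, ip_add_left, star_add, star_ip, star_ip]

variable (A) in
lemma ip_smul_right (x y : X) (a : A) :
    (ip x (MulOpposite.op a • y) : A) = star a * ip x y := by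
  rw [← star_ip, ip_smul_left, star_mul, star_ip]

variable (A) in
lemma ip_complex_smul_left (c : ℂ) (x y : X) : (ip (c • x) y : A) = c • ip x y := by
  have h : c • x = (MulOpposite.op (c • (1 : A))) • x := by
    rw [MulOpposite.op_smul, MulOpposite.op_one, smul_one_smul]
  rw [h, ip_smul_left, mul_smul_comm, mul_one]

variable (A) in
lemma ip_complex_smul_right (c : ℂ) (x y : X) : (ip x (c • y) : A) = star c • ip x y := by
  rw [← star_ip, ip_complex_smul_left, star_smul, star_ip]

variable (A) in
lemma ip_zero_left (y : X) : (ip (0 : X) y : A) = 0 := by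
  have h := ip_add_left (A := A) (0 : X) 0 y
  simpa using h

variable (A) in
lemma ip_zero_right (y : X) : (ip y (0 : X) : A) = 0 := by
  rw [← star_ip, ip_zero_left, star_zero]

/-- The Cauchy-Schwarz inequality for a C*-seminorm. -/
lemma seminorm_ip_sq_le (p : CStarSeminorm A) (x y : X) :
    p (ip x y : A) ^ 2 ≤ p (ip x x : A) * p (ip y y : A) := by
  obtain ⟨B, _, φ, hφ⟩ := p.exists_completion
  let _ : PartialOrder B := CStarAlgebra.spectralOrder B
  have _ : StarOrderedRing B := CStarAlgebra.spectralOrderedRing B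
  have hpos : ∀ a : A, IsPositiveElem a → 0 ≤ φ a := by
    intro a ha
    rw [nonneg_iff_isSelfAdjoint_and_quasispectrumRestricts]
    refine ⟨by rw [IsSelfAdjoint, ← map_star, ha.1], ?_⟩
    rw [QuasispectrumRestricts.nnreal_iff]
    intro r hr
    rw [quasispectrum_eq_spectrum_union_zero] at hr
    rcases hr with hr | hr
    swap
    · exact (Set.mem_singleton_iff.mp hr).ge
    rw [← spectrum.preimage_algebraMap ℂ, Set.mem_preimage] at hr
    obtain ⟨t, ht, h⟩ := ha.2 (AlgHom.spectrum_apply_subset φ a hr)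
    have : t = r := Complex.ofReal_injective h
    exact this ▸ ht
  rw [← hφ, ← hφ, ← hφ]
  set u := φ (ip x x)
  set v := φ (ip y y)
  set w := φ (ip x y)
  have hw : star w = φ (ip y x) := by rw [← map_star, star_ip]
  have hv : 0 ≤ v := hpos _ (ip_self_pos y)
  have hvs : IsSelfAdjoint v := hv.isSelfAdjoint
  have key : ∀ t : ℝ, (2 * t - t ^ 2 * ‖v‖) * ‖w‖ ^ 2 ≤ ‖u‖ := by
    intro t
    by_cases ht : 2 * t - t ^ 2 * ‖v‖ ≤ 0
    · exact (mul_nonpos_of_nonpos_of_nonneg ht (sq_nonneg _)).trans (norm_nonneg _)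
    push Not at ht
    have h1 : 0 ≤ u - (2 * t) • (star w * w) + t ^ 2 • (star w * v * w) := by
      let c : A := (-(t : ℂ)) • ip x y
      have hc : φ c = -(t • w) := by
        change φ ((-(t : ℂ)) • ip x y) = _
        rw [map_smul, neg_smul, Complex.coe_smul]
      have h := hpos _ (ip_self_pos (A := A) (x + MulOpposite.op c • y))
      rw [ip_add_left, ip_add_right, ip_add_right, ip_smul_left, ip_smul_left, ip_smul_right,
        ip_smul_right, map_add, map_add, map_add, map_mul, map_mul, map_mul, map_mul, map_star,
        hc, ← hw] at h
      change 0 ≤ u + star (-(t • w)) * w +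
        (star w * -(t • w) + star (-(t • w)) * v * -(t • w)) at h
      convert h using 1
      simp only [star_neg, star_smul, star_trivial, neg_mul, mul_neg, smul_mul_assoc,
        mul_smul_comm, neg_neg, smul_neg, mul_smul, two_mul, add_smul, pow_two]
      abel
    have h2 : star w * v * w ≤ ‖v‖ • (star w * w) := CStarAlgebra.star_left_conjugate_le_norm_smul
    have h3 : (2 * t - t ^ 2 * ‖v‖) • (star w * w) ≤ u := by
      have h4 := smul_le_smul_of_nonneg_left h2 (sq_nonneg t)
      rw [smul_smul] at h4
      rw [sub_smul, sub_le_iff_le_add]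
      have h5 := h1.trans (add_le_add_right h4 _)
      rw [sub_add_eq_add_sub, sub_nonneg] at h5
      exact h5
    have h6 := CStarAlgebra.norm_le_norm_of_nonneg_of_le
      (smul_nonneg ht.le (star_mul_self_nonneg w)) h3
    rwa [norm_smul, CStarRing.norm_star_mul_self, ← pow_two, Real.norm_of_nonneg ht.le] at h6
  rcases (norm_nonneg v).eq_or_lt with hv0 | hv0
  · rw [← hv0, mul_zero]
    by_contra! hlt
    have h := key ((‖u‖ + 1) / ‖w‖ ^ 2)
    rw [← hv0, mul_zero, sub_zero, mul_assoc, div_mul_cancel₀ _ hlt.ne'] at h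
    linarith [norm_nonneg u]
  · have h := key (1 / ‖v‖)
    have e : 2 * (1 / ‖v‖) - (1 / ‖v‖) ^ 2 * ‖v‖ = 1 / ‖v‖ := by
      field_simp
      norm_num
    rwa [e, one_div, inv_mul_le_iff₀ hv0, mul_comm] at h

/-- The seminorm `x ↦ p (⟨x, x⟩) ^ (1/2)` on a pre-Hilbert module. -/
def modSeminorm (p : CStarSeminorm A) (X : Type*) [AddCommGroup X]
    [Module ℂ X] [Module Aᵐᵒᵖ X] [IsScalarTower ℂ Aᵐᵒᵖ X] [PreHilbertModule A X] :
    Seminorm ℂ X :=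
  Seminorm.of (fun x => Real.sqrt (p (ip x x : A)))
    (fun x y => by
      have h1 := p.nonneg (ip x x : A)
      have h2 := p.nonneg (ip y y : A)
      have hxy : p (ip x y : A) ≤ √(p (ip x x : A)) * √(p (ip y y : A)) := by
        rw [← Real.sqrt_mul h1]
        exact Real.le_sqrt_of_sq_le (seminorm_ip_sq_le p x y)
      have hyx : p (ip y x : A) = p (ip x y : A) := by
        rw [← star_ip, p.star_eq]
      refine Real.sqrt_le_iff.mpr ⟨by positivity, ?_⟩
      rw [ip_add_left, ip_add_right, ip_add_right, add_sq, Real.sq_sqrt h1, Real.sq_sqrt h2]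
      have e1 := map_add_le_add p.toSeminorm (ip x x + ip x y : A) (ip y x + ip y y)
      have e2 := map_add_le_add p.toSeminorm (ip x x : A) (ip x y)
      have e3 := map_add_le_add p.toSeminorm (ip y x : A) (ip y y)
      linarith)
    (fun c x => by
      rw [ip_complex_smul_left, ip_complex_smul_right, map_smul_eq_mul, map_smul_eq_mul,
        norm_star, ← mul_assoc, Real.sqrt_mul (by positivity), Real.sqrt_mul_self (norm_nonneg c)])

lemma modSeminorm_apply (p : CStarSeminorm A) (x : X) :
    modSeminorm p X x = Real.sqrt (p (ip x x : A)) := rfl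

lemma modSeminorm_eq_zero_iff (p : CStarSeminorm A) (x : X) :
    modSeminorm p X x = 0 ↔ p (ip x x : A) = 0 := by
  rw [modSeminorm_apply, Real.sqrt_eq_zero (p.nonneg _)]

lemma modSeminorm_smul_le (p : CStarSeminorm A) (x : X) (a : A) :
    modSeminorm p X (MulOpposite.op a • x) ≤ modSeminorm p X x * p a := by
  rw [modSeminorm_apply, modSeminorm_apply, ip_smul_left, ip_smul_right]
  refine Real.sqrt_le_iff.mpr ⟨mul_nonneg (Real.sqrt_nonneg _) (p.nonneg _), ?_⟩
  rw [mul_pow, Real.sq_sqrt (p.nonneg _)]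
  calc p (star a * ip x x * a) ≤ p (star a * ip x x) * p a := p.mul_le _ _
    _ ≤ p (star a) * p (ip x x : A) * p a := by
        exact mul_le_mul_of_nonneg_right (p.mul_le _ _) (p.nonneg _)
    _ = p (ip x x : A) * p a ^ 2 := by rw [p.star_eq]; ring

lemma seminorm_ip_le (p : CStarSeminorm A) (x y : X) :
    p (ip x y : A) ≤ modSeminorm p X x * modSeminorm p X y := by
  rw [modSeminorm_apply, modSeminorm_apply, ← Real.sqrt_mul (p.nonneg _)]
  exact Real.le_sqrt_of_sq_le (seminorm_ip_sq_le p x y)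

/-- A Hilbert `A`-module: the pre-Hilbert module `X` is complete with respect to the seminorms
`x ↦ P α (⟨x, x⟩) ^ (1/2)` (which automatically separate points if the `P α` do). -/
def IsHilbertModule {Δ : Type*} (P : Δ → CStarSeminorm A) (X : Type*) [AddCommGroup X]
    [Module ℂ X] [Module Aᵐᵒᵖ X] [IsScalarTower ℂ Aᵐᵒᵖ X] [PreHilbertModule A X] : Prop :=
  IsCompleteHausdorff fun α => modSeminorm (P α) X

/-! ### Bounded and adjointable operators -/

/-- Boundedness of an `A`-linear operator (such an operator is automatically `ℂ`-linear, as the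
complex structure of `X` is the one induced by `A`). -/
def IsBddOp {Δ : Type*} (P : Δ → CStarSeminorm A) (T : Module.End Aᵐᵒᵖ X) : Prop :=
  ∀ α, ∃ C : ℝ, 0 < C ∧ ∀ x, modSeminorm (P α) X (T x) ≤ C * modSeminorm (P α) X x

variable (A) in
/-- `S` is an adjoint of `T`. -/
def IsAdjointOp (T S : Module.End Aᵐᵒᵖ X) : Prop := ∀ x y, (ip (T x) y : A) = ip x (S y)

lemma IsAdjointOp.symm {T S : Module.End Aᵐᵒᵖ X} (h : IsAdjointOp A T S) :
    IsAdjointOp A S T := fun x y => by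
  rw [← star_ip, ← h, star_ip]

lemma IsAdjointOp.unique {T S S' : Module.End Aᵐᵒᵖ X} (h : IsAdjointOp A T S)
    (h' : IsAdjointOp A T S') : S = S' := by
  refine LinearMap.ext fun y => ?_
  rw [← sub_eq_zero, ← ip_self_eq_zero (A := A), sub_eq_add_neg]
  have hneg : ∀ x z : X, (ip x (-z) : A) = - ip x z := fun x z => by
    rw [eq_neg_iff_add_eq_zero, ← ip_add_right, neg_add_cancel, ip_zero_right]
  rw [ip_add_right, hneg, ← h, ← h', add_neg_cancel]

lemma IsBddOp.add {Δ : Type*} {P : Δ → CStarSeminorm A} {T S : Module.End Aᵐᵒᵖ X}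
    (hT : IsBddOp P T) (hS : IsBddOp P S) : IsBddOp P (T + S) := fun α => by
  obtain ⟨C, hC, h⟩ := hT α
  obtain ⟨D, hD, h'⟩ := hS α
  refine ⟨C + D, add_pos hC hD, fun x => ?_⟩
  rw [LinearMap.add_apply, add_mul]
  exact (map_add_le_add _ _ _).trans (add_le_add (h x) (h' x))

lemma IsBddOp.mul {Δ : Type*} {P : Δ → CStarSeminorm A} {T S : Module.End Aᵐᵒᵖ X}
    (hT : IsBddOp P T) (hS : IsBddOp P S) : IsBddOp P (T * S) := fun α => by
  obtain ⟨C, hC, h⟩ := hT α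
  obtain ⟨D, hD, h'⟩ := hS α
  refine ⟨C * D, mul_pos hC hD, fun x => ?_⟩
  rw [Module.End.mul_apply, mul_assoc]
  exact (h _).trans (mul_le_mul_of_nonneg_left (h' x) hC.le)

lemma isBddOp_algebraMap {Δ : Type*} (P : Δ → CStarSeminorm A) (c : ℂ) :
    IsBddOp P (algebraMap ℂ (Module.End Aᵐᵒᵖ X) c) := fun α => by
  refine ⟨‖c‖ + 1, by positivity, fun x => ?_⟩
  rw [Module.algebraMap_end_apply, map_smul_eq_mul]
  gcongr
  linarith

lemma isAdjointOp_algebraMap (c : ℂ) :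
    IsAdjointOp A (algebraMap ℂ (Module.End Aᵐᵒᵖ X) c) (algebraMap ℂ _ (star c)) := fun x y => by
  rw [Module.algebraMap_end_apply, Module.algebraMap_end_apply, ip_complex_smul_left,
    ip_complex_smul_right, star_star]

/-- The algebra of bounded adjointable operators on `X`. -/
def adjointableOps {Δ : Type*} (P : Δ → CStarSeminorm A) (X : Type*) [AddCommGroup X]
    [Module ℂ X] [Module Aᵐᵒᵖ X] [IsScalarTower ℂ Aᵐᵒᵖ X] [PreHilbertModule A X] :
    Subalgebra ℂ (Module.End Aᵐᵒᵖ X) where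
  carrier := {T | IsBddOp P T ∧ ∃ S, IsBddOp P S ∧ IsAdjointOp A T S}
  mul_mem' := by
    rintro T T' ⟨hT, S, hS, h⟩ ⟨hT', S', hS', h'⟩
    refine ⟨hT.mul hT', S' * S, hS'.mul hS, fun x y => ?_⟩
    rw [Module.End.mul_apply, Module.End.mul_apply, h, h']
  add_mem' := by
    rintro T T' ⟨hT, S, hS, h⟩ ⟨hT', S', hS', h'⟩
    refine ⟨hT.add hT', S + S', hS.add hS', fun x y => ?_⟩
    rw [LinearMap.add_apply, LinearMap.add_apply, ip_add_left, ip_add_right, h, h']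
  algebraMap_mem' c :=
    ⟨isBddOp_algebraMap P c, _, isBddOp_algebraMap P (star c), isAdjointOp_algebraMap c⟩

/-- The `*`-algebra of bounded adjointable operators on the `A`-module `X`. -/
abbrev AdjEnd {Δ : Type*} (P : Δ → CStarSeminorm A) (X : Type*) [AddCommGroup X]
    [Module ℂ X] [Module Aᵐᵒᵖ X] [IsScalarTower ℂ Aᵐᵒᵖ X] [PreHilbertModule A X] : Type _ :=
  ↥(adjointableOps P X)

namespace AdjEnd

variable {Δ : Type*} {P : Δ → CStarSeminorm A}

/-- The involution sends an operator to its (unique) adjoint. -/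
instance : Star (AdjEnd P X) where
  star T := ⟨T.2.2.choose, T.2.2.choose_spec.1, T.1, T.2.1, T.2.2.choose_spec.2.symm⟩

lemma isAdjointOp_star (T : AdjEnd P X) : IsAdjointOp A T.1 (star T).1 := T.2.2.choose_spec.2

lemma star_eq_of_isAdjointOp {T S : AdjEnd P X} (h : IsAdjointOp A T.1 S.1) : star T = S :=
  Subtype.ext ((isAdjointOp_star T).unique h)

instance : StarRing (AdjEnd P X) where
  star_involutive T := star_eq_of_isAdjointOp (isAdjointOp_star T).symm
  star_mul T S := star_eq_of_isAdjointOp fun x y => by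
    change ip (T.1 (S.1 x)) y = ip x ((star S).1 ((star T).1 y))
    rw [isAdjointOp_star T, isAdjointOp_star S]
  star_add T S := star_eq_of_isAdjointOp fun x y => by
    change ip (T.1 x + S.1 x) y = ip x ((star T).1 y + (star S).1 y)
    rw [ip_add_left, ip_add_right, isAdjointOp_star T, isAdjointOp_star S]

instance : StarModule ℂ (AdjEnd P X) where
  star_smul c T := star_eq_of_isAdjointOp fun x y => by
    change ip (c • T.1 x) y = ip x (star c • (star T).1 y)
    rw [ip_complex_smul_left, ip_complex_smul_right, star_star, isAdjointOp_star T]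

end AdjEnd

end PreHilbert

/-! ### The quotients by the kernel of a C*-seminorm -/

namespace CStarSeminorm

variable {A : Type*} [Ring A] [StarRing A] [Algebra ℂ A] (p : CStarSeminorm A)

/-- The kernel `{a | p a = 0}`. -/
def ker : Ideal A where
  carrier := {a | p a = 0}
  zero_mem' := map_zero p.toSeminorm
  add_mem' {a b} ha hb := le_antisymm
    ((map_add_le_add p.toSeminorm a b).trans (by rw [ha, hb, add_zero])) (p.nonneg _)
  smul_mem' c a ha := le_antisymm
    ((p.mul_le c a).trans (by rw [ha, mul_zero])) (p.nonneg _)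

lemma mem_ker {a : A} : a ∈ p.ker ↔ p a = 0 := Iff.rfl

instance : p.ker.IsTwoSided := ⟨fun {a} b ha => le_antisymm
    ((p.mul_le a b).trans (by rw [p.mem_ker.mp ha, zero_mul])) (p.nonneg _)⟩

lemma star_mem_ker {a : A} (ha : a ∈ p.ker) : star a ∈ p.ker := by
  rw [mem_ker, p.star_eq]; exact ha

/-- The quotient `*`-algebra `A / ker p`. -/
abbrev QuotAlg : Type _ := A ⧸ p.ker

/-- The quotient map `A → A / ker p`. -/
abbrev toQuot (a : A) : p.QuotAlg := Ideal.Quotient.mk p.ker a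

lemma mk_eq_iff {a b : A} : p.toQuot a = p.toQuot b ↔ p (a - b) = 0 := by
  rw [Ideal.Quotient.eq, mem_ker]

lemma mk_surjective : Function.Surjective p.toQuot := Ideal.Quotient.mk_surjective

instance : Star p.QuotAlg where
  star := Quotient.lift (fun a => p.toQuot (star a)) fun a b h => by
    have h' : p.toQuot a = p.toQuot b := Quotient.sound h
    rw [mk_eq_iff] at h' ⊢
    rw [← star_sub, p.star_eq, h']

lemma star_mk (a : A) : star (p.toQuot a) = p.toQuot (star a) := rfl

instance : StarRing p.QuotAlg where
  star_involutive x := by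
    obtain ⟨a, rfl⟩ := p.mk_surjective x
    rw [star_mk, star_mk, star_star]
  star_mul x y := by
    obtain ⟨a, rfl⟩ := p.mk_surjective x
    obtain ⟨b, rfl⟩ := p.mk_surjective y
    exact congrArg p.toQuot (star_mul a b)
  star_add x y := by
    obtain ⟨a, rfl⟩ := p.mk_surjective x
    obtain ⟨b, rfl⟩ := p.mk_surjective y
    exact congrArg p.toQuot (star_add a b)

lemma smul_mk (c : ℂ) (a : A) : c • p.toQuot a = p.toQuot (c • a) := rfl

instance [StarModule ℂ A] : StarModule ℂ p.QuotAlg where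
  star_smul c x := by
    obtain ⟨a, rfl⟩ := p.mk_surjective x
    rw [smul_mk, star_mk, star_mk, star_smul, smul_mk]

/-- The norm `‖a + ker p‖ = p a` on `A / ker p`. -/
def quotNorm : CStarSeminorm p.QuotAlg where
  toSeminorm := Seminorm.of
    (Quotient.lift (fun a => p a) fun a b h => by
      have h' : p (a - b) = 0 := p.mk_eq_iff.mp (Quotient.sound h)
      have h1 := abs_sub_map_le_sub p.toSeminorm a b
      rw [h'] at h1
      exact sub_eq_zero.mp (abs_nonpos_iff.mp h1))
    (by rintro ⟨a⟩ ⟨b⟩; exact map_add_le_add p.toSeminorm a b)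
    (by rintro c ⟨a⟩; exact map_smul_eq_mul p.toSeminorm c a)
  mul_le' := by rintro ⟨a⟩ ⟨b⟩; exact p.mul_le a b
  star_eq' := by rintro ⟨a⟩; exact p.star_eq a
  star_mul_self' := by rintro ⟨a⟩; exact p.star_mul_self a

lemma quotNorm_mk (a : A) : p.quotNorm (p.toQuot a) = p a := rfl

lemma isPositiveElem_mk {a : A} (ha : IsPositiveElem a) : IsPositiveElem (p.toQuot a) := by
  refine ⟨?_, fun z hz => ha.2 ?_⟩
  · rw [IsSelfAdjoint, star_mk, ha.1]
  · exact AlgHom.spectrum_apply_subset (Ideal.Quotient.mkₐ ℂ p.ker) a hz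

section Module

open PreHilbertModule

variable [StarModule ℂ A] (X : Type*) [AddCommGroup X] [Module ℂ X] [Module Aᵐᵒᵖ X]
  [IsScalarTower ℂ Aᵐᵒᵖ X] [PreHilbertModule A X]

/-- The submodule `{x | ⟨x, x⟩ ∈ ker p}`. -/
def nullSub : Submodule Aᵐᵒᵖ X where
  carrier := {x | (ip x x : A) ∈ p.ker}
  zero_mem' := by
    rw [Set.mem_ofPred_eq, ip_zero_left]
    exact zero_mem _
  add_mem' {x y} hx hy := by
    rw [Set.mem_ofPred_eq, mem_ker, ← modSeminorm_eq_zero_iff] at *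
    exact le_antisymm ((map_add_le_add _ x y).trans (by rw [hx, hy, add_zero]))
      (apply_nonneg _ _)
  smul_mem' a x hx := by
    rw [Set.mem_ofPred_eq, mem_ker, ← modSeminorm_eq_zero_iff] at *
    exact le_antisymm ((modSeminorm_smul_le p x a.unop).trans (by rw [hx, zero_mul]))
      (apply_nonneg _ _)

variable {X} in
lemma mem_nullSub {x : X} : x ∈ p.nullSub X ↔ modSeminorm p X x = 0 := by
  rw [modSeminorm_eq_zero_iff]; rfl

/-- The quotient module `X / {x | ⟨x, x⟩ ∈ ker p}` over `A / ker p`. -/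
abbrev QuotMod : Type _ := X ⧸ p.nullSub X

variable {X}

/-- The quotient map of modules. -/
abbrev mkMod (x : X) : p.QuotMod X := Submodule.Quotient.mk x

lemma mkMod_eq_iff {x y : X} : p.mkMod x = p.mkMod y ↔ modSeminorm p X (x - y) = 0 := by
  rw [Submodule.Quotient.eq, mem_nullSub]

lemma mkMod_surjective : Function.Surjective (p.mkMod (X := X)) :=
  Submodule.Quotient.mk_surjective _

/-- The action `(x + N) (a + I) = x a + N`. -/
instance : SMul (p.QuotAlg)ᵐᵒᵖ (p.QuotMod X) where
  smul c := Quotient.map₂ (sa := (Submodule.quotientRel p.ker))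
    (sb := Submodule.quotientRel (p.nullSub X)) (sc := Submodule.quotientRel (p.nullSub X))
    (fun a x => MulOpposite.op a • x)
    (fun a b hab x y hxy => by
      have hab' : p (a - b) = 0 := p.mk_eq_iff.mp (Quotient.sound hab)
      have hxy' : modSeminorm p X (x - y) = 0 := p.mkMod_eq_iff.mp (Quotient.sound hxy)
      refine Quotient.exact (p.mkMod_eq_iff.mpr ?_)
      have h : MulOpposite.op a • x - MulOpposite.op b • y
          = MulOpposite.op (a - b) • x + MulOpposite.op b • (x - y) := by
        rw [MulOpposite.op_sub, sub_smul, smul_sub]; abel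
      rw [h]
      refine le_antisymm ((map_add_le_add _ _ _).trans ?_) (apply_nonneg _ _)
      have h1 := modSeminorm_smul_le p x (a - b)
      have h2 := modSeminorm_smul_le p (x - y) b
      rw [hab', mul_zero] at h1
      rw [hxy', zero_mul] at h2
      linarith) c.unop

lemma op_mk_smul_mkMod (a : A) (x : X) :
    MulOpposite.op (p.toQuot a) • p.mkMod x = p.mkMod (MulOpposite.op a • x) := rfl

instance : Module (p.QuotAlg)ᵐᵒᵖ (p.QuotMod X) where
  one_smul := by
    rintro ⟨x⟩; exact congrArg p.mkMod (one_smul Aᵐᵒᵖ x)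
  mul_smul := by
    rintro ⟨⟨a⟩⟩ ⟨⟨b⟩⟩ ⟨x⟩; exact congrArg p.mkMod (mul_smul (MulOpposite.op a) (MulOpposite.op b) x)
  smul_zero := by
    rintro ⟨⟨a⟩⟩; exact congrArg p.mkMod (smul_zero (MulOpposite.op a))
  smul_add := by
    rintro ⟨⟨a⟩⟩ ⟨x⟩ ⟨y⟩; exact congrArg p.mkMod (smul_add (MulOpposite.op a) x y)
  add_smul := by
    rintro ⟨⟨a⟩⟩ ⟨⟨b⟩⟩ ⟨x⟩; exact congrArg p.mkMod (add_smul (MulOpposite.op a) (MulOpposite.op b) x)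
  zero_smul := by
    rintro ⟨x⟩; exact congrArg p.mkMod (zero_smul Aᵐᵒᵖ x)

instance : IsScalarTower ℂ (p.QuotAlg)ᵐᵒᵖ (p.QuotMod X) where
  smul_assoc := by
    rintro c ⟨⟨a⟩⟩ ⟨x⟩; exact congrArg p.mkMod (smul_assoc c (MulOpposite.op a) x)

/-- The inner product `⟨x + N, y + N⟩ = ⟨x, y⟩ + I`. -/
def quotIp : p.QuotMod X → p.QuotMod X → p.QuotAlg :=
  Quotient.map₂ (sa := Submodule.quotientRel (p.nullSub X))
    (sb := Submodule.quotientRel (p.nullSub X)) (sc := Submodule.quotientRel p.ker)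
    (fun x y => (ip x y : A))
    (fun x x' hx y y' hy => by
      have hx' : modSeminorm p X (x - x') = 0 := p.mkMod_eq_iff.mp (Quotient.sound hx)
      have hy' : modSeminorm p X (y - y') = 0 := p.mkMod_eq_iff.mp (Quotient.sound hy)
      refine Quotient.exact (p.mk_eq_iff.mpr ?_)
      have h : (ip x y - ip x' y' : A) = ip (x - x') y + ip x' (y - y') := by
        have e1 := ip_add_left (A := A) (x - x') x' y
        have e2 := ip_add_right A x' (y - y') y'
        rw [sub_add_cancel] at e1 e2
        rw [e1, e2]; abel
      rw [h]
      refine le_antisymm ((map_add_le_add _ _ _).trans ?_) (apply_nonneg _ _)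
      have h1 := seminorm_ip_le p (x - x') y
      have h2 := seminorm_ip_le p x' (y - y')
      rw [hx', zero_mul] at h1
      rw [hy', mul_zero] at h2
      linarith)

instance : PreHilbertModule p.QuotAlg (p.QuotMod X) where
  ip := p.quotIp
  ip_self_pos := by rintro ⟨x⟩; exact p.isPositiveElem_mk (ip_self_pos x)
  ip_self_eq_zero := by
    rintro ⟨x⟩
    exact (Submodule.Quotient.mk_eq_zero p.ker (x := ip x x)).trans
      (Submodule.Quotient.mk_eq_zero (p.nullSub X) (x := x)).symm
  ip_add_left := by rintro ⟨x⟩ ⟨x'⟩ ⟨y⟩; exact congrArg p.toQuot (ip_add_left x x' y)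
  ip_smul_left := by rintro ⟨x⟩ ⟨y⟩ ⟨a⟩; exact congrArg p.toQuot (ip_smul_left x y a)
  star_ip := by rintro ⟨x⟩ ⟨y⟩; exact congrArg p.toQuot (star_ip x y)

lemma ip_mkMod (x y : X) : (ip (p.mkMod x) (p.mkMod y) : p.QuotAlg) = p.toQuot (ip x y) := rfl

lemma modSeminorm_mkMod (x : X) :
    modSeminorm p.quotNorm (p.QuotMod X) (p.mkMod x) = modSeminorm p X x := rfl

end Module

end CStarSeminorm

/-! ### The induced operators -/

section Induced

variable {A X Δ : Type*} [Ring A] [StarRing A] [Algebra ℂ A] [StarModule ℂ A] [AddCommGroup X]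
  [Module ℂ X] [Module Aᵐᵒᵖ X] [IsScalarTower ℂ Aᵐᵒᵖ X] [PreHilbertModule A X]
  {P : Δ → CStarSeminorm A}

/-- The operator `x + N ↦ T x + N` on the quotient module, for bounded `T`. -/
def inducedEnd (T : Module.End Aᵐᵒᵖ X) (hT : IsBddOp P T) (α : Δ) :
    Module.End ((P α).QuotAlg)ᵐᵒᵖ ((P α).QuotMod X) where
  toFun := Submodule.mapQ ((P α).nullSub X) ((P α).nullSub X) T fun x hx => by
    obtain ⟨C, -, h⟩ := hT α
    rw [CStarSeminorm.mem_nullSub] at hx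
    rw [Submodule.mem_comap, CStarSeminorm.mem_nullSub]
    have h' := h x
    rw [hx, mul_zero] at h'
    exact le_antisymm h' (apply_nonneg _ _)
  map_add' := map_add _
  map_smul' := by
    rintro ⟨⟨a⟩⟩ ⟨x⟩
    exact congrArg (P α).mkMod (map_smul T (MulOpposite.op a) x)

lemma inducedEnd_mkMod (T : Module.End Aᵐᵒᵖ X) (hT : IsBddOp P T) (α : Δ) (x : X) :
    inducedEnd T hT α ((P α).mkMod x) = (P α).mkMod (T x) := rfl

lemma isBddOp_inducedEnd (T : Module.End Aᵐᵒᵖ X) (hT : IsBddOp P T) (α : Δ) :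
    IsBddOp (fun _ : Unit => (P α).quotNorm) (inducedEnd T hT α) := fun _ => by
  obtain ⟨C, hC, h⟩ := hT α
  refine ⟨C, hC, ?_⟩
  rintro ⟨x⟩
  exact h x

/-- The adjointable operators on the quotient module `X / {x | P α (⟨x, x⟩) = 0}` over the normed
algebra `A / ker (P α)` (a family of seminorms with one member). -/
abbrev QuotAdjEnd (P : Δ → CStarSeminorm A) (X : Type*) [AddCommGroup X] [Module ℂ X]
    [Module Aᵐᵒᵖ X] [IsScalarTower ℂ Aᵐᵒᵖ X] [PreHilbertModule A X] (α : Δ) : Type _ :=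
  AdjEnd (fun _ : Unit => (P α).quotNorm) ((P α).QuotMod X)

/-- The induced operator `x + N ↦ T x + N`, as an adjointable operator. -/
def AdjEnd.induced (T : AdjEnd P X) (α : Δ) : QuotAdjEnd P X α :=
  ⟨inducedEnd T.1 T.2.1 α, isBddOp_inducedEnd _ _ _,
    inducedEnd (star T).1 (star T).2.1 α, isBddOp_inducedEnd _ _ _, by
      rintro ⟨x⟩ ⟨y⟩
      exact congrArg (P α).toQuot (AdjEnd.isAdjointOp_star T x y)⟩

end Induced

end LCStar

end

/-! Everything rests on one criterion, `isUnit_iff_forall_induced`: `T` is invertible exactly when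
every `T_α` is. Since `T ↦ T_α` is a unital `*`-homomorphism, applying the criterion to `z - T`
gives the spectra. The seminorms of `X` separate points, so the `T_α` together determine `T`; this
gives self-adjointness, and positivity is the conjunction of the two.

In the criterion, only the converse needs work. Invertibility of `T_α` bounds `T` from below in the
seminorm of index `α` (`exists_bound_below`). These bounds make `T` injective, and completeness of
`X` makes its range closed, so it remains to prove that the range is dense.

Density comes from C*-theory. The operators on `X_α` carry a C*-seminorm (`exists_opSeminorm`), and
in the associated C*-completion an invertible `b` satisfies `‖1 - t b b*‖ < 1` for all small `t >
0`. Hence, for finitely many indices at once, a single `t` makes `1 - t T T*` a contraction. The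
iteration `x ↦ x + t T*(y - T x)` multiplies the residual `y - T x` by `1 - t T T*`, so the residual
tends to zero in these seminorms (`exists_approx`).

The resulting inverse of `T` is bounded. It is adjointable because the same argument inverts `T*`,
and the inverse of `T*` is the required adjoint. -/

namespace LCStar

/-! ### Surjectivity on complete locally convex spaces -/

/-- A bounded operator which is bounded below and has dense range on a complete Hausdorff locally
convex space is surjective. -/
lemma IsCompleteHausdorff.surjective {E Δ : Type*} [AddCommGroup E] [Module ℂ E]
    {P : Δ → Seminorm ℂ E} (hP : IsCompleteHausdorff P) (T : E →ₗ[ℂ] E)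
    (hb : ∀ α, ∃ C : ℝ, 0 < C ∧ ∀ x, P α (T x) ≤ C * P α x)
    (hl : ∀ α, ∃ C : ℝ, 0 < C ∧ ∀ x, P α x ≤ C * P α (T x))
    (hd : ∀ (y : E) (F : Finset Δ) (ε : ℝ), 0 < ε → ∃ x, ∀ α ∈ F, P α (y - T x) < ε) :
    Function.Surjective T := by
  -- The two-sided bounds say that pulling the uniformity of one seminorm back along `T` returns
  -- that uniformity. Comap commutes with infima, so the same then holds for the whole family.
  have hone : ∀ α, UniformSpace.comap T (P α).toSeminormedAddCommGroup.toUniformSpace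
      = (P α).toSeminormedAddCommGroup.toUniformSpace := fun α => by
    obtain ⟨C, hC, h⟩ := hb α
    obtain ⟨D, hD, h'⟩ := hl α
    let : SeminormedAddCommGroup E := (P α).toSeminormedAddCommGroup
    have h1 : UniformContinuous T :=
      (AddMonoidHomClass.lipschitz_of_bound T C h).uniformContinuous
    have h2 : AntilipschitzWith D.toNNReal T :=
      AddMonoidHomClass.antilipschitz_of_bound T fun x => by
        rw [Real.coe_toNNReal _ hD.le]; exact h' x
    exact (isUniformInducing_iff_uniformSpace.mp (h2.isUniformInducing h1))
  let : UniformSpace E := seminormUniformSpace P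
  have : CompleteSpace E := hP.complete
  have : IsUniformAddGroup E := isUniformAddGroup_iInf fun α =>
    (P α).toSeminormedAddCommGroup.to_isUniformAddGroup
  have hw : WithSeminorms P :=
    (SeminormFamily.withSeminorms_iff_uniformSpace_eq_iInf P).mpr rfl
  have : T1Space E := hw.T1_of_separating fun x hx => by
    by_contra! h
    exact hx (hP.separating x h)
  have hT : IsUniformInducing T := by
    rw [isUniformInducing_iff_uniformSpace]
    change UniformSpace.comap T (⨅ α, _) = ⨅ α, _
    rw [UniformSpace.comap_iInf]
    exact iInf_congr hone
  -- The range is a uniformly inducing image of a complete space, hence complete, and complete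
  -- subsets of a Hausdorff space are closed.
  have hclosed : IsClosed (Set.range T) := hT.isComplete_range.isClosed
  intro y
  change y ∈ Set.range T
  -- Basic neighbourhoods are balls for the supremum of finitely many seminorms, so approximation on
  -- each finite `F` is enough.
  rw [← hclosed.closure_eq, mem_closure_iff_nhds_basis hw.hasBasis_ball]
  rintro ⟨F, ε⟩ hε
  obtain ⟨x, hx⟩ := hd y F ε hε
  refine ⟨T x, ⟨x, rfl⟩, ?_⟩
  rw [Seminorm.mem_ball, map_sub_rev]
  exact Seminorm.finset_sup_apply_lt hε hx

/-! ### A contraction estimate in C*-algebras -/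

/-- For an invertible element `b` of a C*-algebra, `1 - t b b*` is a strict contraction for small
`t > 0`. -/
lemma eventually_norm_one_sub_smul_mul_star_lt_one {B : Type*} [CStarAlgebra B] {b : B}
    (hb : IsUnit b) :
    ∀ᶠ t : ℝ in nhdsWithin 0 (Set.Ioi 0), ‖1 - t • (b * star b)‖ < 1 := by
  let _ : PartialOrder B := CStarAlgebra.spectralOrder B
  have _ : StarOrderedRing B := CStarAlgebra.spectralOrderedRing B
  obtain ⟨c, hbc, -⟩ := isUnit_iff_exists.mp hb
  -- With `b c = 1`, one has `1 = b (c c*) b* ≤ ‖c c*‖ b b*`.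
  have h1 : (1 : B) ≤ ‖c * star c‖ • (b * star b) := by
    have h := CStarAlgebra.star_left_conjugate_le_norm_smul (a := star b) (b := c * star c)
      (hb := .mul_star_self c)
    rwa [star_star, show b * (c * star c) * star b = (b * c) * star (b * c) by
      rw [star_mul]; simp only [mul_assoc], hbc, star_one, mul_one] at h
  -- Adding 1 keeps `M` positive even when `B` is the zero algebra. The same device makes `K`
  -- invertible.
  set M := ‖c * star c‖ + 1
  have hM : 0 < M := by positivity
  have h2 : (1 : B) ≤ M • (b * star b) := h1.trans (by
    rw [add_smul, one_smul]
    exact le_add_of_nonneg_right (mul_star_self_nonneg b))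
  set K := ‖b * star b‖ + 1
  have hK : 0 < K := by positivity
  have h3 : b * star b ≤ algebraMap ℝ B K :=
    (CStarAlgebra.norm_le_iff_le_algebraMap _ hK.le (mul_star_self_nonneg b)).mp (by simp [K])
  have hsmul : ∀ r : ℝ, algebraMap ℝ B r = r • 1 := Algebra.algebraMap_eq_smul_one
  -- The condition `t < K⁻¹` gives `0 ≤ 1 - t b b*`, and `1 ≤ M b b*` gives `1 - t b b* ≤ 1 - t /
  -- M`. The condition `t < M` keeps this bound nonnegative, so it bounds the norm as well.
  filter_upwards [Ioo_mem_nhdsGT (lt_min hM (inv_pos.mpr hK))] with t ⟨ht, ht'⟩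
  have htM : t < M := ht'.trans_le (min_le_left _ _)
  have htK : t < K⁻¹ := ht'.trans_le (min_le_right _ _)
  have h4 : 0 ≤ 1 - t • (b * star b) := by
    rw [sub_nonneg]
    refine (smul_le_smul_of_nonneg_left h3 ht.le).trans ?_
    rw [hsmul, smul_smul]
    have h : t * K ≤ 1 := by
      rw [← inv_mul_cancel₀ hK.ne']; gcongr
    calc (t * K) • (1 : B) ≤ (1 : ℝ) • 1 := smul_le_smul_of_nonneg_right h zero_le_one
      _ = 1 := one_smul _ _
  have h5 : 0 ≤ 1 - t / M := by
    rw [sub_nonneg, div_le_one hM]; exact htM.le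
  refine lt_of_le_of_lt ((CStarAlgebra.norm_le_iff_le_algebraMap _ h5 h4).mpr ?_)
    (sub_lt_self 1 (div_pos ht hM))
  rw [hsmul, sub_smul, one_smul]
  refine sub_le_sub_left ?_ _
  have h6 := smul_le_smul_of_nonneg_left h2 (div_pos ht hM).le
  rwa [smul_smul, div_mul_cancel₀ _ hM.ne'] at h6

/-! ### Operator norms as C*-seminorms -/

section OperatorSeminorm

open PreHilbertModule

variable {A X Δ : Type*} [Ring A] [StarRing A] [Algebra ℂ A] [StarModule ℂ A] [AddCommGroup X]
  [Module ℂ X] [Module Aᵐᵒᵖ X] [IsScalarTower ℂ Aᵐᵒᵖ X] [PreHilbertModule A X]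

lemma modSeminorm_sq (p : CStarSeminorm A) (x : X) : modSeminorm p X x ^ 2 = p (ip x x : A) := by
  rw [modSeminorm_apply, Real.sq_sqrt (p.nonneg _)]

namespace AdjEnd

variable {P : Δ → CStarSeminorm A}

/-- The seminorms on the algebra of adjointable operators: the operator norms with respect to
the seminorms of the module. -/
lemma exists_opSeminorm (P : Δ → CStarSeminorm A) (X : Type*) [AddCommGroup X]
    [Module ℂ X] [Module Aᵐᵒᵖ X] [IsScalarTower ℂ Aᵐᵒᵖ X] [PreHilbertModule A X] (α : Δ) :
    ∃ q : CStarSeminorm (AdjEnd P X), ∀ (T : AdjEnd P X) (x : X),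
      modSeminorm (P α) X (T.1 x) ≤ q T * modSeminorm (P α) X x := by
  let : SeminormedAddCommGroup X := (modSeminorm (P α) X).toSeminormedAddCommGroup
  have hn : ∀ x : X, ‖x‖ = modSeminorm (P α) X x := fun _ => rfl
  let : NormedSpace ℂ X := ⟨fun c x => (map_smul_eq_mul (modSeminorm (P α) X) c x).le⟩
  -- With the single seminorm of index `α`, `X` is a seminormed space, and the operator norm makes
  -- sense without completeness or the Hausdorff property.
  let L : AdjEnd P X →ₗ[ℂ] (X →L[ℂ] X) :=
    { toFun := fun T => LinearMap.mkContinuousOfExistsBound (T.1.restrictScalars ℂ) (by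
        obtain ⟨C, -, h⟩ := T.2.1 α
        exact ⟨C, h⟩)
      map_add' := fun _ _ => rfl
      map_smul' := fun _ _ => rfl }
  have hL : ∀ T x, L T x = T.1 x := fun _ _ => rfl
  have hip : ∀ x y : X, (P α) (ip x y : A) ≤ ‖x‖ * ‖y‖ := fun x y => seminorm_ip_le (P α) x y
  -- The nontrivial half of the C*-identity: `‖T x‖²` is the seminorm of `⟨x, T* T x⟩`, to which
  -- Cauchy-Schwarz applies.
  have hle : ∀ T : AdjEnd P X, ‖L T‖ ^ 2 ≤ ‖L (star T * T)‖ := fun T => by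
    refine (Real.le_sqrt (norm_nonneg _) (norm_nonneg _)).mp ?_
    refine ContinuousLinearMap.opNorm_le_bound _ (Real.sqrt_nonneg _) fun x => ?_
    refine (sq_le_sq₀ (norm_nonneg _) (by positivity)).mp ?_
    rw [mul_pow, Real.sq_sqrt (norm_nonneg _), hn (L T x), modSeminorm_sq, hL,
      isAdjointOp_star T]
    calc (P α) (ip x ((star T).1 (T.1 x)) : A) ≤ ‖x‖ * ‖L (star T * T) x‖ := hip _ _
      _ ≤ ‖x‖ * (‖L (star T * T)‖ * ‖x‖) := by
          gcongr; exact ContinuousLinearMap.le_opNorm _ _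
      _ = ‖L (star T * T)‖ * ‖x‖ ^ 2 := by ring
  have hmul : ∀ T S : AdjEnd P X, ‖L (T * S)‖ ≤ ‖L T‖ * ‖L S‖ := fun T S =>
    ContinuousLinearMap.opNorm_comp_le (L T) (L S)
  -- From `‖T‖² ≤ ‖T* T‖ ≤ ‖T*‖ ‖T‖`, cancel `‖T‖` unless it is zero.
  have hstar_le : ∀ T : AdjEnd P X, ‖L T‖ ≤ ‖L (star T)‖ := fun T => by
    have h := (hle T).trans (hmul _ _)
    rcases (norm_nonneg (L T)).eq_or_lt with h0 | h0
    · rw [← h0]; exact norm_nonneg _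
    · rw [pow_two] at h
      exact le_of_mul_le_mul_right h h0
  have hstar : ∀ T : AdjEnd P X, ‖L (star T)‖ = ‖L T‖ := fun T =>
    le_antisymm (by simpa only [star_star] using hstar_le (star T)) (hstar_le T)
  refine ⟨{ toSeminorm := (normSeminorm ℂ (X →L[ℂ] X)).comp L
            mul_le' := hmul
            star_eq' := hstar
            star_mul_self' := fun T => le_antisymm ((hmul _ _).trans ?_) (hle T) }, fun T x => ?_⟩
  · rw [hstar, ← pow_two]; rfl
  · exact (L T).le_opNorm x

/-- An invertible adjointable operator `T` gives a contraction `1 - t T T*`. -/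
lemma eventually_exists_contraction {T : AdjEnd P X} (hT : IsUnit T) (α : Δ) :
    ∀ᶠ t : ℝ in nhdsWithin 0 (Set.Ioi 0), ∃ k : ℝ, 0 ≤ k ∧ k < 1 ∧ ∀ x : X,
      modSeminorm (P α) X (x - (t : ℂ) • T.1 ((star T).1 x)) ≤ k * modSeminorm (P α) X x := by
  obtain ⟨q, hq⟩ := exists_opSeminorm P X α
  -- `φ` need not be injective: invertibility is pushed forward to `B`, and only the norm estimate
  -- is brought back.
  obtain ⟨B, _, φ, hφ⟩ := q.exists_completion
  filter_upwards [eventually_norm_one_sub_smul_mul_star_lt_one (hT.map φ)] with t ht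
  refine ⟨_, norm_nonneg _, ht, fun x => ?_⟩
  have h : 1 - t • (φ T * star (φ T)) = φ (1 - (t : ℂ) • (T * star T)) := by
    rw [map_sub, map_one, map_smul, map_mul, map_star, Complex.coe_smul]
  rw [h, hφ]
  exact hq (1 - (t : ℂ) • (T * star T)) x

end AdjEnd

end OperatorSeminorm

/-! ### Induced operators and invertibility -/

section Induced

open PreHilbertModule

variable {A X Δ : Type*} [Ring A] [StarRing A] [Algebra ℂ A] [StarModule ℂ A] [AddCommGroup X]
  [Module ℂ X] [Module Aᵐᵒᵖ X] [IsScalarTower ℂ Aᵐᵒᵖ X] [PreHilbertModule A X]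
  {P : Δ → CStarSeminorm A}

namespace AdjEnd

lemma induced_mkMod (T : AdjEnd P X) (α : Δ) (x : X) :
    (T.induced α).1 ((P α).mkMod x) = (P α).mkMod (T.1 x) := rfl

lemma ext_mkMod {α : Δ} {S T : QuotAdjEnd P X α}
    (h : ∀ x, S.1 ((P α).mkMod x) = T.1 ((P α).mkMod x)) : S = T := by
  refine Subtype.ext (LinearMap.ext fun x => ?_)
  obtain ⟨x, rfl⟩ := (P α).mkMod_surjective x
  exact h x

lemma star_induced (T : AdjEnd P X) (α : Δ) : star (T.induced α) = (star T).induced α :=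
  star_eq_of_isAdjointOp <| by
    rintro ⟨x⟩ ⟨y⟩
    exact congrArg (P α).toQuot (isAdjointOp_star T x y)

variable (X P) in
/-- The homomorphism `T ↦ T_α`. -/
def inducedHom (α : Δ) : AdjEnd P X →ₐ[ℂ] QuotAdjEnd P X α where
  toFun T := T.induced α
  map_one' := ext_mkMod fun _ => rfl
  map_mul' _ _ := ext_mkMod fun _ => rfl
  map_zero' := ext_mkMod fun _ => rfl
  map_add' _ _ := ext_mkMod fun _ => rfl
  commutes' _ := ext_mkMod fun _ => rfl

lemma inducedHom_apply (T : AdjEnd P X) (α : Δ) : inducedHom X P α T = T.induced α := rfl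

/-- If `S` and `T` agree modulo every null submodule, all seminorms of `S x - T x` vanish. This is
the converse direction for self-adjointness. -/
lemma ext_induced (hX : Separating fun α => modSeminorm (P α) X) {S T : AdjEnd P X}
    (h : ∀ α, S.induced α = T.induced α) : S = T := by
  refine Subtype.ext (LinearMap.ext fun x => sub_eq_zero.mp (hX _ fun α => ?_))
  rw [← CStarSeminorm.mkMod_eq_iff, ← induced_mkMod, ← induced_mkMod, h]

/-- The constant is a bound for the inverse of `T_α`, applied to the class of `T x`. -/
lemma exists_bound_below {T : AdjEnd P X} {α : Δ} (h : IsUnit (T.induced α)) :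
    ∃ C : ℝ, 0 < C ∧ ∀ x, modSeminorm (P α) X x ≤ C * modSeminorm (P α) X (T.1 x) := by
  obtain ⟨S, -, hS⟩ := isUnit_iff_exists.mp h
  obtain ⟨C, hC, hb⟩ := S.2.1 ()
  refine ⟨C, hC, fun x => ?_⟩
  have h1 : S.1 ((P α).mkMod (T.1 x)) = (P α).mkMod x :=
    congrArg (fun R : QuotAdjEnd P X α => R.1 ((P α).mkMod x)) hS
  have h2 := hb ((P α).mkMod (T.1 x))
  rwa [h1] at h2

/-- If all the `T_α` are invertible, the range of `T` is dense. -/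
lemma exists_approx {T : AdjEnd P X} (h : ∀ α, IsUnit (T.induced α)) (y : X) (F : Finset Δ)
    {ε : ℝ} (hε : 0 < ε) : ∃ x, ∀ α ∈ F, modSeminorm (P α) X (y - T.1 x) < ε := by
  -- One `t` must serve all indices in `F`. Each index allows every sufficiently small `t > 0`, and
  -- `F` is finite.
  have hk : ∀ᶠ t : ℝ in nhdsWithin 0 (Set.Ioi 0), ∀ α ∈ F, ∃ k : ℝ, 0 ≤ k ∧ k < 1 ∧ ∀ x : X,
      modSeminorm (P α) X (x - (t : ℂ) • T.1 ((star T).1 x)) ≤ k * modSeminorm (P α) X x := by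
    refine (Filter.eventually_all_finset F).mpr fun α _ => ?_
    filter_upwards [eventually_exists_contraction (h α) ()] with t ⟨k, hk0, hk1, hk⟩
    refine ⟨k, hk0, hk1, fun x => ?_⟩
    have h1 := hk ((P α).mkMod x)
    rw [star_induced] at h1
    exact h1
  obtain ⟨t, ht⟩ := hk.exists
  choose! k hk0 hk1 hk using ht
  have hiter : ∀ n : ℕ, ∃ x, ∀ α ∈ F,
      modSeminorm (P α) X (y - T.1 x) ≤ k α ^ n * modSeminorm (P α) X y := by
    intro n
    induction n with
    | zero => exact ⟨0, fun α _ => by rw [map_zero, sub_zero, pow_zero, one_mul]⟩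
    | succ n ih =>
      obtain ⟨x, hx⟩ := ih
      -- The new residual is `(1 - t T T*)(y - T x)`, so one more factor `k α` is gained. The
      -- iteration starts from `x = 0`, with residual `y`.
      refine ⟨x + (t : ℂ) • (star T).1 (y - T.1 x), fun α hα => ?_⟩
      rw [map_add, LinearMap.map_smul_of_tower, ← sub_sub, pow_succ', mul_assoc]
      exact (hk α hα _).trans (mul_le_mul_of_nonneg_left (hx α hα) (hk0 α hα))
  have hn : ∀ᶠ n : ℕ in Filter.atTop, ∀ α ∈ F, k α ^ n * modSeminorm (P α) X y < ε := by
    refine (Filter.eventually_all_finset F).mpr fun α hα => ?_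
    have h1 := (tendsto_pow_atTop_nhds_zero_of_lt_one (hk0 α hα) (hk1 α hα)).mul_const
      (modSeminorm (P α) X y)
    rw [zero_mul] at h1
    exact h1.eventually (gt_mem_nhds hε)
  obtain ⟨n, hn⟩ := hn.exists
  obtain ⟨x, hx⟩ := hiter n
  exact ⟨x, fun α hα => (hx α hα).trans_lt (hn α hα)⟩

/-- Bounds below give injectivity and, with dense range, surjectivity; the same constants bound the
inverse. An adjoint of the inverse is not yet available, so it is only an `A`-linear endomorphism
here. -/
lemma exists_bdd_inverse {T : AdjEnd P X} (hX : IsHilbertModule P X)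
    (h : ∀ α, IsUnit (T.induced α)) :
    ∃ S : Module.End Aᵐᵒᵖ X, IsBddOp P S ∧ (∀ x, T.1 (S x) = x) ∧ ∀ x, S (T.1 x) = x := by
  have hinj : Function.Injective T.1 := by
    refine (injective_iff_map_eq_zero T.1).mpr fun x hx => hX.separating x fun α => ?_
    obtain ⟨C, -, hC⟩ := exists_bound_below (h α)
    have h1 := hC x
    rw [hx, map_zero, mul_zero] at h1
    exact le_antisymm h1 (apply_nonneg _ _)
  have hsurj : Function.Surjective T.1 :=
    IsCompleteHausdorff.surjective hX (T.1.restrictScalars ℂ) T.2.1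
      (fun α => exists_bound_below (h α)) (fun y F ε hε => exists_approx h y F hε)
  let e := LinearEquiv.ofBijective T.1 ⟨hinj, hsurj⟩
  have he : ∀ x, T.1 (e.symm x) = x := e.apply_symm_apply
  refine ⟨e.symm.toLinearMap, fun α => ?_, he, e.symm_apply_apply⟩
  obtain ⟨C, hC, hb⟩ := exists_bound_below (h α)
  refine ⟨C, hC, fun x => ?_⟩
  have h1 := hb (e.symm x)
  rwa [he] at h1

/-- An adjointable operator on a Hilbert module is invertible if and only if all the induced
operators are. -/
lemma isUnit_iff_forall_induced (hX : IsHilbertModule P X) (T : AdjEnd P X) :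
    IsUnit T ↔ ∀ α, IsUnit (T.induced α) := by
  refine ⟨fun h α => h.map (inducedHom X P α), fun h => ?_⟩
  have h' : ∀ α, IsUnit ((star T).induced α) := fun α => star_induced T α ▸ (h α).star
  obtain ⟨S, hSb, hTS, hST⟩ := exists_bdd_inverse hX h
  obtain ⟨R, hRb, hTR, -⟩ := exists_bdd_inverse hX h'
  -- With `S` inverse to `T` and `R` a right inverse of `T*`: `⟨S x, y⟩ = ⟨S x, T* R y⟩ = ⟨T S x, R
  -- y⟩ = ⟨x, R y⟩`.
  have hadj : IsAdjointOp A S R := fun x y => by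
    rw [← hTR y, ← isAdjointOp_star T, hTS, hTR]
  refine isUnit_iff_exists.mpr ⟨⟨S, hSb, R, hRb, hadj⟩, ?_, ?_⟩
  · exact Subtype.ext (LinearMap.ext hTS)
  · exact Subtype.ext (LinearMap.ext hST)

/-- The invertibility criterion applied to `z - T`, whose induced operators are `z - T_α`. -/
lemma spectrum_eq_iUnion (hX : IsHilbertModule P X) (T : AdjEnd P X) :
    spectrum ℂ T = ⋃ α, spectrum ℂ (T.induced α) := by
  ext z
  rw [Set.mem_iUnion, spectrum.mem_iff, isUnit_iff_forall_induced hX, not_forall]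
  refine exists_congr fun α => ?_
  rw [spectrum.mem_iff, ← inducedHom_apply, ← inducedHom_apply, map_sub, AlgHom.commutes]

lemma isSelfAdjoint_iff_forall_induced (hX : Separating fun α => modSeminorm (P α) X)
    (T : AdjEnd P X) : IsSelfAdjoint T ↔ ∀ α, IsSelfAdjoint (T.induced α) := by
  simp only [IsSelfAdjoint, star_induced]
  exact ⟨fun h α => by rw [h], fun h => ext_induced hX h⟩

end AdjEnd

end Induced

end LCStar

theorem proposition3p1 {A X Δ : Type*} [Ring A] [StarRing A] [Algebra ℂ A] [StarModule ℂ A]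
    [AddCommGroup X] [Module ℂ X] [Module Aᵐᵒᵖ X] [IsScalarTower ℂ Aᵐᵒᵖ X]
    [LCStar.PreHilbertModule A X] (P : Δ → LCStar.CStarSeminorm A)
    (hA : LCStar.IsLocallyCStarAlgebra P) (hX : LCStar.IsHilbertModule P X)
    (T : LCStar.AdjEnd P X) :
    (spectrum ℂ T = ⋃ α : Δ, spectrum ℂ (T.induced α)) ∧
    (IsSelfAdjoint T ↔ ∀ α : Δ, IsSelfAdjoint (T.induced α)) ∧
    (LCStar.IsPositiveElem T ↔ ∀ α : Δ, LCStar.IsPositiveElem (T.induced α)) := by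
  have ha := LCStar.AdjEnd.spectrum_eq_iUnion hX T
  have hb := LCStar.AdjEnd.isSelfAdjoint_iff_forall_induced hX.separating T
  refine ⟨ha, hb, ?_⟩
  -- A union lies in `[0, ∞)` exactly when each of its members does, so both halves of positivity
  -- can be tested index by index.
  simp only [LCStar.IsPositiveElem, hb, ha, Set.iUnion_subset_iff, forall_and]
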